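/- All groups below are profinite, subgroups are closed, homomorphisms are continuous, and generation is topological; $d(H)$ denotes the minimal number of topological generators of $H$ ($\infty$ if there is no finite generating set). Let $G$ be a finitely generated prosoluble group and $p$ a prime. Let $\{G_t\mid t\in T\}$ be a family of pro-$p$ subgroups of $G$ indexed by a profinite space $T$, such that $G$ is $\mathcal S$-projective relative to $\{G_t\mid t\in T\}$, where $\mathcal S$ is the class of finite soluble groups, in either of the following two senses. (A) $G$ acts continuously on $T$, $G_t$ is the stabilizer of $t$, and the pile $(G,T)$ is $\mathcal S$-projective, that is: let $A,B$ be finite soluble groups acting on finite sets $X,Y$, let $\varphi:(G,T)\to(A,X)$ be a morphism (a homomorphism together with an equivariant continuous map), and let $\alpha:(B,Y)\to(A,X)$ be a morphism which is an epimorphism (it is surjective on groups and on sets, and every $x\in X$ is the image of some $y\in Y$ with $\alpha(B_y)=A_x$) and which is rigid (it maps each stabilizer $B_y$ isomorphically onto $A_{\alpha(y)}$ and induces a bijection $Y/B\to X/A$). Then there is a morphism $\gamma:(G,T)\to(B,Y)$ with $\alpha\gamma=\varphi$. (B) The family is continuous (for every open subgroup $U\le G$ the set $\{t\mid G_t\le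 U\}$ is open in $T$), the set $\mathcal G=\{G_t\mid t\in T\}$ is closed under conjugation in $G$, distinct indices carry nontrivial subgroups that are not contained in one another (if $1\neq G_s\le G_t$ then $s=t$), and every finite $\mathcal S$-embedding problem of pairs for $(G,\mathcal G)$ has a solution, that is: let $A,B$ be finite soluble groups with conjugation-closed sets of subgroups $\mathcal A,\mathcal B$, let $\alpha:B\to A$ be an epimorphism with $\{\alpha(\Delta)\mid\Delta\in\mathcal B\}=\mathcal A$, and let $\varphi:G\to A$ be a homomorphism mapping each $\Gamma\in\mathcal G$ into a member of $\mathcal A$ and such that for each $\Gamma\in\mathcal G$ there are $\Delta\in\mathcal B$ and a homomorphism $\gamma_\Gamma:\Gamma\to\Delta$ with $\alpha\gamma_\Gamma=\varphi|_\Gamma$. Then there is a homomorphism $\gamma:G\to B$ with $\alpha\gamma=\varphi$ that maps each $\Gamma\in\mathcal G$ into a member of $\mathcal B$. Put $T_0=\{t\in T\mid G_t\neq 1\}$. In case (A) let $G$ act on $T_0$ by the given action, and in case (B) by conjugation of the subgroups $G_t$ (so $s,t\in T_0$ are in the same orbit if and only if $G_s$ and $G_t$ are conjugate in $G$). Then $T_0$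 is closed in $T$, the number of $G$-orbits in $T_0$ is at most $d(G)$, and $\sum_t d(G_t)\le d(G)$, where $t$ runs through any set of representatives of the $G$-orbits in $T_0$. -/

import Mathlib

universe u v w

/-- A (profinite) group all of whose finite continuous quotients are soluble. -/
def IsProsoluble (G : Type u) [Group G] [TopologicalSpace G] : Prop :=
  ∀ (N : Subgroup G) [N.Normal], IsOpen (N : Set G) → Group.IsSolvable (G ⧸ N)

/-- A (profinite) group all of whose finite continuous quotients are `p`-groups. -/
def IsProP (p : ℕ) (G : Type u) [Group G] [TopologicalSpace G] : Prop :=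
  ∀ (N : Subgroup G) [N.Normal], IsOpen (N : Set G) → IsPGroup p (G ⧸ N)

/-- The set `S` generates `G` topologically. -/
def TopGenerates (G : Type u) [Group G] [TopologicalSpace G] (S : Set G) : Prop :=
  Dense (Subgroup.closure S : Set G)

/-- `d(G)`: the minimal number of topological generators
(`⊤` if `G` is not topologically finitely generated). -/
noncomputable def topRank (G : Type u) [Group G] [TopologicalSpace G] : ℕ∞ :=
  ⨅ (S : Finset G) (_ : TopGenerates G (S : Set G)), (S.card : ℕ∞)

/-- The subgroups `K` and `H` of `G` are conjugate by `g`, that is `K = g H g⁻¹`. -/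
def IsConjBy {G : Type u} [Group G] (g : G) (H K : Subgroup G) : Prop :=
  K = H.map (MulAut.conj g).toMonoidHom

/-- A set of subgroups of `G` that is closed under conjugation. -/
def ConjClosed {G : Type u} [Group G] (𝒢 : Set (Subgroup G)) : Prop :=
  ∀ H ∈ 𝒢, ∀ (g : G) (K : Subgroup G), IsConjBy g H K → K ∈ 𝒢

/-- A continuous family of closed subgroups: for every open subgroup `U`,
the set of indices `t` with `Γ t ≤ U` is open. -/
structure IsContinuousFamily {G : Type u} [Group G] [TopologicalSpace G]
    {T : Type v} [TopologicalSpace T] (Γ : T → Subgroup G) : Prop where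
  isClosed : ∀ t, IsClosed (Γ t : Set G)
  isOpen_le : ∀ U : Subgroup G, IsOpen (U : Set G) → IsOpen {t | Γ t ≤ U}

/-- `φ(𝒢) ⊆ 𝒜` in the sense of pairs: every `φ(H)`, `H ∈ 𝒢`, lies in some member of `𝒜`. -/
def MapsFamily {G : Type u} {A : Type v} [Group G] [Group A] (φ : G →* A)
    (𝒢 : Set (Subgroup G)) (𝒜 : Set (Subgroup A)) : Prop :=
  ∀ H ∈ 𝒢, ∃ D ∈ 𝒜, H.map φ ≤ D

/-- `G` is `𝒮`-projective relative to the set `𝒢` of subgroups (`𝒮` = finite soluble groups):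
every finite `𝒮`-embedding problem of pairs
`φ : (G, 𝒢) → (A, 𝒜)`, `α : (B, ℬ) → (A, 𝒜)`, with `α` an epimorphism of pairs and with
`φ` liftable to `(B, ℬ)` on each member of `𝒢`, has a solution.
(`A` is a quotient of `B`, so it is finite soluble as well.) -/
def IsSProjectiveRel (G : Type u) [Group G] [TopologicalSpace G]
    (𝒢 : Set (Subgroup G)) : Prop :=
  ∀ (A B : Type) [Group A] [Group B] [Finite A] [Finite B]
    [TopologicalSpace A] [DiscreteTopology A] [TopologicalSpace B] [DiscreteTopology B]
    (𝒜 : Set (Subgroup A)) (ℬ : Set (Subgroup B)) (φ : G →* A) (α : B →* A),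
    Group.IsSolvable B → ConjClosed 𝒜 → ConjClosed ℬ →
    Continuous φ → MapsFamily φ 𝒢 𝒜 →
    Function.Surjective α → (fun D : Subgroup B => D.map α) '' ℬ = 𝒜 →
    (∀ H ∈ 𝒢, ∃ D ∈ ℬ, ∃ l : ↥H →* B,
      Continuous l ∧ (∀ x, l x ∈ D) ∧ ∀ x : ↥H, α (l x) = φ (x : G)) →
    ∃ γ : G →* B, Continuous γ ∧ MapsFamily γ 𝒢 ℬ ∧ ∀ x, α (γ x) = φ x

/-- A morphism of group piles `(G, T) → (H, X)`: a continuous homomorphism together with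
a continuous map that is equivariant with respect to it. -/
structure PileHom (G : Type u) (T : Type v) (H : Type w) (X : Type w)
    [Group G] [TopologicalSpace G] [TopologicalSpace T] [MulAction G T]
    [Group H] [TopologicalSpace H] [TopologicalSpace X] [MulAction H X] where
  hom : G →* H
  map : T → X
  continuous_hom : Continuous hom
  continuous_map : Continuous map
  map_smul : ∀ (g : G) (t : T), map (g • t) = hom g • map t

/-- An epimorphism of group piles. -/
structure PileHom.IsEpi {G : Type u} {T : Type v} {H : Type w} {X : Type w}
    [Group G] [TopologicalSpace G] [TopologicalSpace T] [MulAction G T]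
    [Group H] [TopologicalSpace H] [TopologicalSpace X] [MulAction H X]
    (α : PileHom G T H X) : Prop where
  surj_hom : Function.Surjective α.hom
  surj_map : Function.Surjective α.map
  exists_stab : ∀ x : X, ∃ t : T, α.map t = x ∧
    (MulAction.stabilizer G t).map α.hom = MulAction.stabilizer H x

/-- The map `T/G → X/H` on orbit spaces induced by a morphism of group piles. -/
def PileHom.orbitMap {G : Type u} {T : Type v} {H : Type w} {X : Type w}
    [Group G] [TopologicalSpace G] [TopologicalSpace T] [MulAction G T]
    [Group H] [TopologicalSpace H] [TopologicalSpace X] [MulAction H X]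
    (α : PileHom G T H X) :
    MulAction.orbitRel.Quotient G T → MulAction.orbitRel.Quotient H X :=
  Quotient.map α.map (by
    rintro _ b ⟨g, rfl⟩
    exact ⟨α.hom g, (α.map_smul g b).symm⟩)

/-- A rigid morphism of group piles: it maps each point stabilizer isomorphically onto the
stabilizer of the image point, and induces a homeomorphism of orbit spaces. -/
structure PileHom.IsRigid {G : Type u} {T : Type v} {H : Type w} {X : Type w}
    [Group G] [TopologicalSpace G] [TopologicalSpace T] [MulAction G T]
    [Group H] [TopologicalSpace H] [TopologicalSpace X] [MulAction H X]
    (α : PileHom G T H X) : Prop where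
  bijOn_stab : ∀ t : T, Set.BijOn α.hom (MulAction.stabilizer G t : Set G)
    (MulAction.stabilizer H (α.map t) : Set H)
  isHomeomorph_orbitMap : IsHomeomorph α.orbitMap

/-- The group pile `(G, T)` is `𝒮`-projective (`𝒮` = finite soluble groups): every finite rigid
`𝒮`-embedding problem of piles `φ : (G, T) → (A, X)`, `α : (B, Y) → (A, X)` has a solution. -/
def IsSProjectivePile (G : Type u) (T : Type v) [Group G] [TopologicalSpace G]
    [TopologicalSpace T] [MulAction G T] : Prop :=
  ∀ (A X B Y : Type) [Group A] [Group B] [Finite A] [Finite X] [Finite B] [Finite Y]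
    [TopologicalSpace A] [DiscreteTopology A] [TopologicalSpace X] [DiscreteTopology X]
    [TopologicalSpace B] [DiscreteTopology B] [TopologicalSpace Y] [DiscreteTopology Y]
    [MulAction A X] [MulAction B Y]
    (φ : PileHom G T A X) (α : PileHom B Y A X),
    Group.IsSolvable B → α.IsEpi → α.IsRigid →
    ∃ γ : PileHom G T B Y,
      (∀ g, α.hom (γ.hom g) = φ.hom g) ∧ ∀ t, α.map (γ.map t) = φ.map t

/-- `T₀ = {t | Γ t ≠ 1}`. -/
def nontrivialIndices {G : Type u} [Group G] {T : Type v} (Γ : T → Subgroup G) : Set T :=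
  {t | Γ t ≠ ⊥}

/-- The relation on indices: `Γ s` and `Γ t` are conjugate in `G`. If different indices in `T₀`
carry different subgroups, then on `T₀` its classes are the orbits of the conjugation action,
in which `g • s` is the index `t` with `Γ t = g (Γ s) g⁻¹`. -/
def conjIndexSetoid {G : Type u} [Group G] {T : Type v} (Γ : T → Subgroup G) : Setoid T where
  r s t := ∃ g : G, IsConjBy g (Γ s) (Γ t)
  iseqv := by
    refine ⟨fun s => ⟨1, ?_⟩, ?_, ?_⟩
    · ext x; simp [Subgroup.mem_map]
    · rintro s t ⟨g, h⟩
      refine ⟨g⁻¹, ?_⟩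
      unfold IsConjBy at *
      rw [h]
      ext x
      simp [Subgroup.mem_map, mul_assoc]
    · rintro s t r ⟨g, h⟩ ⟨k, h'⟩
      refine ⟨k * g, ?_⟩
      unfold IsConjBy at *
      rw [h', h]
      ext x
      simp [Subgroup.mem_map, mul_assoc]

/-- `T₀` is closed and meets at most `d(G)` classes of `r`, and for every system `R` of
representatives of the classes in `T₀` the sum of the `d(Γ t)`, `t ∈ R`, is at most `d(G)`.
(Systems of representatives are finite, because the number of classes is at most `d(G)`.) -/
structure GeneratorBound {G : Type u} [Group G] [TopologicalSpace G]
    {T : Type v} [TopologicalSpace T] (r : Setoid T) (Γ : T → Subgroup G) : Prop where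
  isClosed : IsClosed (nontrivialIndices Γ)
  card_le : ((Quotient.mk r) '' nontrivialIndices Γ).encard ≤ topRank G
  sum_le : ∀ R : Finset T, (R : Set T) ⊆ nontrivialIndices Γ →
    (∀ t ∈ nontrivialIndices Γ, ∃! s, s ∈ R ∧ r s t) →
    ∑ t ∈ R, topRank ↥(Γ t) ≤ topRank G

/-! Everything follows from one statement: if `t i` are finitely many inequivalent indices in `T₀`
and `f i` maps `Γ (t i)` onto a finite abelian group `V i` with open kernel, then `G` maps onto `∏ V
i` with open kernel. With `V i` elementary abelian of rank `k i ≤ d(Γ (t i))`, linear algebra over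
`ZMod p` gives `∑ k i ≤ d(G)`. Hence there are at most `d(G)` classes, the sum bound holds, and `T₀`
is closed as a finite union of closed classes (`generatorBound_of_surjective`).

The surjection is the `V`-component of a solution of an embedding problem `A × V → A` with `V = ∏ V
i` and `A` a finite quotient of `G` (or a product of two) through which every `f i` factors. The
problem is split as one of groups, so its content lies in the extra structure, chosen to force the
solution to reproduce `f i` on `Γ (t i)` up to inversion or conjugation.

For piles, that structure is the action on `X × V` twisted by a cocycle `c : A → X → V` extending
the `f i` (`exists_cocycle`, `IsSProjectivePile.exists_hom_of_cocycle`). For pairs, it consists of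
the conjugates of the graphs of the `f i`, together with all subgroups whose projection to `A` is
too small to contain a conjugate of the image of some `Γ (t i)` (`IsSProjectiveRel.exists_hom`). -/

/-! ### Open normal subgroups, compactness and finite quotients. -/

theorem exists_openNormalSubgroup_notMem_sup {G : Type u} [Group G] [TopologicalSpace G]
    [IsTopologicalGroup G] [CompactSpace G] [T2Space G] [TotallyDisconnectedSpace G]
    {H : Subgroup G} (hH : IsClosed (H : Set G)) {x : G} (hx : x ∉ H) :
    ∃ N : OpenNormalSubgroup G, x ∉ H ⊔ (N : Subgroup G) := by
  have ho : IsOpen ((fun y => x * y) ⁻¹' (H : Set G)ᶜ) :=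
    hH.isOpen_compl.preimage (continuous_const_mul x)
  obtain ⟨N, hN⟩ := ProfiniteGrp.exist_openNormalSubgroup_sub_open_nhds_of_one ho (by simpa using hx)
  refine ⟨N, fun h => ?_⟩
  obtain ⟨y, hy, z, hz, rfl⟩ := Subgroup.mem_sup_of_normal_right.mp h
  have := hN (inv_mem hz)
  simp only [Set.mem_preimage, Set.mem_compl_iff, SetLike.mem_coe] at this
  exact this (by simpa using hy)

/-- Uniformity over a compact space of a monotone condition on open normal subgroups. -/
theorem exists_openNormalSubgroup_forall {G : Type u} [Group G] [TopologicalSpace G]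
    {K : Type v} [TopologicalSpace K] [CompactSpace K]
    (P : K → OpenNormalSubgroup G → Prop)
    (mono : ∀ k N N', N' ≤ N → P k N → P k N')
    (loc : ∀ k, ∃ N, ∀ᶠ k' in nhds k, P k' N) (M : OpenNormalSubgroup G) :
    ∃ N ≤ M, ∀ k, P k N := by
  choose N hN using loc
  obtain ⟨s, hs⟩ := CompactSpace.elim_nhds_subcover (fun k => {k' | P k' (N k)}) hN
  have key : ∀ s : Finset K, ∃ L ≤ M, ∀ k ∈ s, L ≤ N k := by
    classical
    intro s
    induction s using Finset.induction_on with
    | empty => exact ⟨M, le_rfl, by simp⟩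
    | insert a s _ ih =>
      obtain ⟨L, hL, h⟩ := ih
      refine ⟨L ⊓ N a, inf_le_left.trans hL, fun k hk => ?_⟩
      rcases Finset.mem_insert.mp hk with rfl | hk
      · exact inf_le_right
      · exact inf_le_left.trans (h k hk)
  obtain ⟨L, hL, h⟩ := key s
  refine ⟨L, hL, fun k => ?_⟩
  have : k ∈ ⋃ x ∈ s, {k' | P k' (N x)} := by rw [hs]; trivial
  simp only [Set.mem_iUnion] at this
  obtain ⟨x, hx, hk⟩ := this
  exact mono k _ _ (h x hx) hk

theorem exists_openNormalSubgroup_forall_le {G : Type u} [Group G] [TopologicalSpace G]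
    [IsTopologicalGroup G] [CompactSpace G] {ι : Type v} [Finite ι]
    (P : ι → OpenNormalSubgroup G → Prop)
    (mono : ∀ i N N', N' ≤ N → P i N → P i N') (ex : ∀ i, ∃ N, P i N) (M : OpenNormalSubgroup G) :
    ∃ N ≤ M, ∀ i, P i N := by
  let : TopologicalSpace ι := ⊥
  have : DiscreteTopology ι := ⟨rfl⟩
  refine exists_openNormalSubgroup_forall P mono (fun i => ?_) M
  obtain ⟨N, hN⟩ := ex i
  exact ⟨N, by simpa [nhds_discrete] using hN⟩

/-- A homomorphism with open kernel on a subgroup is trivial on its intersection with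
some open normal subgroup. -/
theorem exists_openNormalSubgroup_ker {G : Type u} [Group G] [TopologicalSpace G]
    [IsTopologicalGroup G] [CompactSpace G] [T2Space G] [TotallyDisconnectedSpace G]
    {H : Subgroup G} {V : Type w} [Group V] (f : H →* V) (hf : IsOpen (f.ker : Set H)) :
    ∃ N : OpenNormalSubgroup G, ∀ x : H, (x : G) ∈ N → f x = 1 := by
  obtain ⟨U, hU, hUf⟩ := isOpen_induced_iff.mp hf
  have h1 : (1 : G) ∈ U := by
    have : (1 : H) ∈ Subtype.val ⁻¹' U := by rw [hUf]; exact f.ker.one_mem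
    exact this
  obtain ⟨N, hN⟩ := ProfiniteGrp.exist_openNormalSubgroup_sub_open_nhds_of_one hU h1
  refine ⟨N, fun x hx => ?_⟩
  have : x ∈ Subtype.val ⁻¹' U := hN hx
  rw [hUf] at this
  exact this

/-- A map between underlying sets through which a homomorphism on a subgroup factors. -/
theorem exists_factor {G : Type u} [Group G] {A : Type*} [Group A] {V : Type w} [Group V]
    (φ : G →* A) {H : Subgroup G} (f : H →* V) (h : ∀ x : H, φ x = 1 → f x = 1) :
    ∃ F : A → V, ∀ x : H, F (φ x) = f x := by
  classical
  refine ⟨fun a => if h : ∃ x : H, φ x = a then f h.choose else 1, fun x => ?_⟩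
  have hx : ∃ y : H, φ y = φ x := ⟨x, rfl⟩
  simp only [hx, dif_pos]
  have h1 := h (hx.choose * x⁻¹) (by simp [hx.choose_spec])
  rw [map_mul, map_inv, mul_inv_eq_one] at h1
  exact h1

/-- A finite quotient realized on a type in the lowest universe. -/
theorem exists_finite_quotient {G : Type u} [Group G] [TopologicalSpace G]
    [IsTopologicalGroup G] [CompactSpace G] (hsol : IsProsoluble G) (N : OpenNormalSubgroup G) :
    ∃ (A : Type) (_ : Group A) (_ : Finite A) (φ : G →* A),
      Group.IsSolvable A ∧ Function.Surjective φ ∧ φ.ker = (N : Subgroup G) := by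
  have hsolv : Group.IsSolvable (G ⧸ (N : Subgroup G)) := hsol _ N.isOpen'
  have hfin : Finite (G ⧸ (N : Subgroup G)) := Subgroup.quotient_finite_of_isOpen _ N.isOpen'
  obtain ⟨A, hA, hAf, ⟨e⟩⟩ := Finite.exists_type_univ_nonempty_mulEquiv.{u, 0} (G ⧸ (N : Subgroup G))
  refine ⟨A, hA, .of_fintype A, e.toMonoidHom.comp (QuotientGroup.mk' _),
    Group.isSolvable_of_surjective (f := e.toMonoidHom) e.surjective,
    e.surjective.comp (QuotientGroup.mk'_surjective _), ?_⟩
  ext x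
  simp

theorem continuous_of_isOpen_ker {G : Type u} [Group G] [TopologicalSpace G]
    [IsTopologicalGroup G] {A : Type*} [Group A] [TopologicalSpace A] [DiscreteTopology A]
    (φ : G →* A) (h : IsOpen (φ.ker : Set G)) : Continuous φ := by
  refine continuous_of_continuousAt_one φ ?_
  rw [ContinuousAt, nhds_discrete A, Filter.tendsto_pure]
  filter_upwards [h.mem_nhds φ.ker.one_mem] with x hx
  rw [map_one]; exact hx

theorem isOpen_ker_of_continuous {G : Type u} [Group G] [TopologicalSpace G]
    {A : Type*} [Group A] [TopologicalSpace A] [DiscreteTopology A]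
    (φ : G →* A) (h : Continuous φ) : IsOpen (φ.ker : Set G) :=
  (isOpen_discrete ({1} : Set A)).preimage h

/-! ### Elementary abelian quotients and numbers of generators. -/

theorem surjective_of_mulSingle {G : Type u} [Group G] {ι : Type*} [Finite ι] [DecidableEq ι]
    {V : ι → Type*} [∀ i, Group (V i)] (χ : G →* ∀ i, V i)
    (h : ∀ i (v : V i), ∃ g, χ g = Pi.mulSingle i v) : Function.Surjective χ := by
  rw [← MonoidHom.range_eq_top, eq_top_iff]
  exact fun x _ => Subgroup.pi_mem_of_mulSingle_mem x fun i => h i (x i)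

/-- A maximal subgroup of a finite `p`-group is normal of index `p`; the character is the quotient
by one that contains `H`. -/
theorem IsPGroup.exists_surjective_zmod {Q : Type u} [Group Q] [Finite Q] {p : ℕ} [Fact p.Prime]
    (hQ : IsPGroup p Q) {H : Subgroup Q} (hH : H ≠ ⊤) :
    ∃ χ : Q →* Multiplicative (ZMod p), Function.Surjective χ ∧ H ≤ χ.ker := by
  obtain ⟨M, hM, hHM⟩ := (eq_top_or_exists_le_coatom H).resolve_left hH
  have := hQ.isNilpotent
  have hN : M.Normal := Subgroup.NormalizerCondition.normal_of_coatom M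
    Group.normalizerCondition_of_isNilpotent hM
  have : Nontrivial (Q ⧸ M) := QuotientGroup.nontrivial_iff.mpr hM.1
  have hQM : IsPGroup p (Q ⧸ M) := hQ.to_quotient M
  obtain ⟨n, hn, hcard⟩ := hQM.nontrivial_iff_card.mp inferInstance
  obtain ⟨x, hx⟩ := exists_prime_orderOf_dvd_card' (G := Q ⧸ M) p
    (hcard ▸ dvd_pow_self p hn.ne')
  have hx1 : x ≠ 1 := by
    rintro rfl
    rw [orderOf_one] at hx
    exact (Fact.out : p.Prime).one_lt.ne hx
  have htop : (Subgroup.zpowers x).comap (QuotientGroup.mk' M) = ⊤ := by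
    refine hM.2 _ (lt_of_le_of_ne ?_ ?_)
    · intro y hy
      have : (QuotientGroup.mk' M) y = 1 := (QuotientGroup.eq_one_iff y).mpr hy
      rw [Subgroup.mem_comap, this]
      exact one_mem _
    · intro heq
      obtain ⟨y, rfl⟩ := QuotientGroup.mk'_surjective M x
      have : y ∈ M := by rw [heq]; exact Subgroup.mem_zpowers _
      exact hx1 ((QuotientGroup.eq_one_iff y).mpr this)
  have htop' : Subgroup.zpowers x = ⊤ := by
    rw [eq_top_iff]
    intro y _
    obtain ⟨z, rfl⟩ := QuotientGroup.mk'_surjective M y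
    have : z ∈ (Subgroup.zpowers x).comap (QuotientGroup.mk' M) := by rw [htop]; trivial
    exact this
  have hc : Nat.card (Q ⧸ M) = p := by
    rw [← Subgroup.card_top, ← htop', Nat.card_zpowers, hx]
  let e : Q ⧸ M ≃* Multiplicative (ZMod p) := mulEquivOfPrimeCardEq (p := p) hc (by simp)
  refine ⟨e.toMonoidHom.comp (QuotientGroup.mk' M),
    e.surjective.comp (QuotientGroup.mk'_surjective M), fun y hy => ?_⟩
  have : (QuotientGroup.mk' M) y = 1 := (QuotientGroup.eq_one_iff y).mpr (hHM hy)
  rw [MonoidHom.mem_ker, MonoidHom.comp_apply, this, map_one]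

/-- A pro-`p` group maps onto an elementary abelian group of rank `k` for each `k ≤ d(P)`. -/
theorem IsProP.exists_surjective_elementary {P : Type u} [Group P] [TopologicalSpace P]
    [IsTopologicalGroup P] [CompactSpace P] [T2Space P] [TotallyDisconnectedSpace P]
    {p : ℕ} [Fact p.Prime] (hP : IsProP p P) (k : ℕ) (hk : (k : ℕ∞) ≤ topRank P) :
    ∃ f : P →* (Fin k → Multiplicative (ZMod p)),
      IsOpen (f.ker : Set P) ∧ Function.Surjective f := by
  classical
  induction k with
  | zero =>
    refine ⟨1, ?_, fun x => ⟨1, Subsingleton.elim _ _⟩⟩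
    rw [MonoidHom.ker_one]; exact isOpen_univ
  | succ k ih =>
    obtain ⟨f, hfo, hfs⟩ := ih (le_trans (by exact_mod_cast k.le_succ) hk)
    -- The `k` lifts of the standard basis are too few to generate `P`, so some character `g` kills
    -- the subgroup `H` they generate. As `f` is already surjective on `H`, the pair `(g, f)` is
    -- surjective.
    choose e he using fun i : Fin k =>
      hfs (Pi.mulSingle i (Multiplicative.ofAdd (1 : ZMod p)))
    let S : Finset P := Finset.univ.image e
    have hScard : (S.card : ℕ∞) < k + 1 := by
      have : S.card ≤ k := Finset.card_image_le.trans (by simp)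
      exact_mod_cast Nat.lt_succ_of_le this
    have hS : ¬ TopGenerates P (S : Set P) := fun h => by
      have h1 : topRank P ≤ S.card := iInf₂_le S h
      exact absurd (hk.trans h1) (not_le.mpr (by exact_mod_cast hScard))
    set H := Subgroup.closure (S : Set P) with hH
    have hcl : ∃ x, x ∉ H.topologicalClosure := by
      by_contra! hall
      exact hS fun x => hall x
    obtain ⟨x, hx⟩ := hcl
    obtain ⟨N, hN⟩ := exists_openNormalSubgroup_notMem_sup H.isClosed_topologicalClosure hx
    have : Finite (P ⧸ (N : Subgroup P)) := Subgroup.quotient_finite_of_isOpen _ N.isOpen'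
    have hne : H.map (QuotientGroup.mk' (N : Subgroup P)) ≠ ⊤ := by
      intro htop
      have hxm : QuotientGroup.mk' (N : Subgroup P) x ∈ H.map (QuotientGroup.mk' (N : Subgroup P)) := by
        rw [htop]; trivial
      have : x ∈ (H.map (QuotientGroup.mk' (N : Subgroup P))).comap (QuotientGroup.mk' _) := hxm
      rw [Subgroup.comap_map_eq, QuotientGroup.ker_mk'] at this
      exact hN (sup_le_sup_right H.le_topologicalClosure _ this)
    obtain ⟨χ, hχs, hχ⟩ := (hP (N : Subgroup P) N.isOpen').exists_surjective_zmod hne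
    let g : P →* Multiplicative (ZMod p) := χ.comp (QuotientGroup.mk' (N : Subgroup P))
    have hgs : Function.Surjective g := hχs.comp (QuotientGroup.mk'_surjective _)
    have hgH : ∀ y ∈ H, g y = 1 := fun y hy => hχ (Subgroup.mem_map_of_mem _ hy)
    have hfH : ∀ v, ∃ y ∈ H, f y = v := by
      intro v
      change v ∈ H.map f
      refine Subgroup.pi_mem_of_mulSingle_mem v fun i => ?_
      have h1 : Pi.mulSingle i (Multiplicative.ofAdd (1 : ZMod p)) ∈ H.map f :=
        ⟨e i, Subgroup.subset_closure (by simp [S]), he i⟩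
      have h2 : Pi.mulSingle i (v i) =
          (Pi.mulSingle i (Multiplicative.ofAdd (1 : ZMod p)) :
            Fin k → Multiplicative (ZMod p)) ^ (Multiplicative.toAdd (v i)).val := by
        rw [← Pi.mulSingle_pow, ← ofAdd_nsmul, nsmul_one, ZMod.natCast_zmod_val, ofAdd_toAdd]
      rw [h2]
      exact pow_mem h1 _
    let F : P →* (Fin (k + 1) → Multiplicative (ZMod p)) :=
      { toFun := fun x => Fin.cons (g x) (f x)
        map_one' := by
          funext i; refine Fin.cases ?_ (fun j => ?_) i <;> simp
        map_mul' := fun a b => by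
          funext i; refine Fin.cases ?_ (fun j => ?_) i <;> simp }
    refine ⟨F, ?_, fun w => ?_⟩
    · have hle : (N : Subgroup P) ⊓ f.ker ≤ F.ker := by
        rintro y ⟨hy1, hy2⟩
        have h1 : g y = 1 := by
          have : (QuotientGroup.mk' (N : Subgroup P)) y = 1 := (QuotientGroup.eq_one_iff y).mpr hy1
          simp only [g, MonoidHom.comp_apply, this, map_one]
        have h2 : f y = 1 := hy2
        change (Fin.cons (g y) (f y) : Fin (k + 1) → Multiplicative (ZMod p)) = 1
        rw [h1, h2]
        funext i; refine Fin.cases ?_ (fun j => ?_) i <;> simp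
      exact Subgroup.isOpen_mono hle (N.isOpen'.inter hfo)
    · obtain ⟨a, ha⟩ := hgs (w 0)
      obtain ⟨b, hb, hfb⟩ := hfH ((f a)⁻¹ * Fin.tail w)
      refine ⟨a * b, ?_⟩
      change (Fin.cons (g (a * b)) (f (a * b)) : Fin (k + 1) → Multiplicative (ZMod p)) = w
      rw [map_mul, map_mul, hgH b hb, hfb, ha, mul_one, mul_inv_cancel_left]
      exact Fin.cons_self_tail w

/-- The elements whose image lies in the span of the images of a generating set form an open, hence
closed, subgroup, so they are all of `G`. Thus these images span a space of dimension `∑ i, k i`. -/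
theorem sum_le_topRank {G : Type u} [Group G] [TopologicalSpace G] [IsTopologicalGroup G]
    {p : ℕ} [Fact p.Prime] {ι : Type*} [Fintype ι] (k : ι → ℕ)
    (χ : G →* ∀ i, Fin (k i) → Multiplicative (ZMod p)) (hχ : IsOpen (χ.ker : Set G))
    (hs : Function.Surjective χ) : ((∑ i, k i : ℕ) : ℕ∞) ≤ topRank G := by
  classical
  refine le_iInf₂ fun S hS => ?_
  let q : G → ∀ i, Fin (k i) → ZMod p := fun g i j => Multiplicative.toAdd (χ g i j)
  let M : Submodule (ZMod p) (∀ i, Fin (k i) → ZMod p) :=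
    Submodule.span (ZMod p) (S.image q : Finset _)
  let L : Subgroup G :=
    { carrier := {g | q g ∈ M}
      one_mem' := by
        have : q 1 = 0 := by funext i j; simp [q]
        change q 1 ∈ M; rw [this]; exact M.zero_mem
      mul_mem' := fun {a b} ha hb => by
        have : q (a * b) = q a + q b := by funext i j; simp [q]
        change q (a * b) ∈ M; rw [this]; exact M.add_mem ha hb
      inv_mem' := fun {a} ha => by
        have : q a⁻¹ = - q a := by funext i j; simp [q]
        change q a⁻¹ ∈ M; rw [this]; exact M.neg_mem ha }
  have hLo : IsOpen (L : Set G) := by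
    refine Subgroup.isOpen_mono (H₁ := χ.ker) (fun g hg => ?_) hχ
    have : q g = 0 := by
      funext i j
      simp only [q, (MonoidHom.mem_ker).mp hg]; rfl
    change q g ∈ M
    rw [this]; exact M.zero_mem
  have hSL : Subgroup.closure (S : Set G) ≤ L := by
    rw [Subgroup.closure_le]
    intro g hg
    exact Submodule.subset_span (by simpa using ⟨g, hg, rfl⟩)
  have hLtop : ∀ g, g ∈ L := by
    have hcl : IsClosed (L : Set G) := L.isClosed_of_isOpen hLo
    intro g
    have h1 : closure (Subgroup.closure (S : Set G) : Set G) ⊆ L := closure_minimal hSL hcl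
    exact h1 (hS g)
  have hM : M = ⊤ := by
    rw [eq_top_iff]
    intro v _
    obtain ⟨g, hg⟩ := hs fun i j => Multiplicative.ofAdd (v i j)
    have : q g = v := by funext i j; simp [q, hg]
    rw [← this]; exact hLtop g
  have h1 : Module.finrank (ZMod p) M ≤ (S.image q).card := finrank_span_finset_le_card _
  rw [hM, finrank_top, Module.finrank_pi_fintype] at h1
  simp only [Module.finrank_fin_fun] at h1
  exact_mod_cast h1.trans Finset.card_image_le

theorem one_le_topRank {P : Type u} [Group P] [TopologicalSpace P] [T1Space P] [Nontrivial P] :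
    1 ≤ topRank P := by
  refine le_iInf₂ fun S hS => ?_
  rcases S.eq_empty_or_nonempty with rfl | hne
  · exfalso
    obtain ⟨x, hx⟩ := exists_ne (1 : P)
    have h1 : closure (Subgroup.closure ((∅ : Finset P) : Set P) : Set P) = {1} := by simp
    have h2 := hS x
    rw [h1] at h2
    exact hx h2
  · exact_mod_cast hne.card_pos

/-! ### Reduction to surjections onto products of abelian groups. -/

/-- The hypothesis `H` isolates what either notion of projectivity has to provide; the rest is
counting. -/
theorem generatorBound_of_surjective {G : Type u} [Group G] [TopologicalSpace G]
    [IsTopologicalGroup G] [CompactSpace G] [T2Space G] [TotallyDisconnectedSpace G]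
    (hfg : ∃ S : Finset G, TopGenerates G (S : Set G))
    {p : ℕ} [Fact p.Prime] {T : Type v} [TopologicalSpace T] (r : Setoid T) (Γ : T → Subgroup G)
    (hcl : ∀ t, IsClosed (Γ t : Set G)) (hP : ∀ t, IsProP p (Γ t))
    (hclass : ∀ t ∈ nontrivialIndices Γ,
      IsClosed {s | r t s} ∧ ∀ s, r t s → s ∈ nontrivialIndices Γ)
    (H : ∀ (n : ℕ) (t : Fin n → T), (∀ i, t i ∈ nontrivialIndices Γ) →
      (∀ i j, r (t i) (t j) → i = j) →
      ∀ (V : Fin n → Type) [∀ i, CommGroup (V i)] [∀ i, Finite (V i)] (f : ∀ i, Γ (t i) →* V i),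
      (∀ i, IsOpen ((f i).ker : Set (Γ (t i)))) → (∀ i, Function.Surjective (f i)) →
      ∃ χ : G →* ∀ i, V i, IsOpen (χ.ker : Set G) ∧ Function.Surjective χ) :
    GeneratorBound r Γ := by
  -- Natural numbers `k i` below the ranks are used because the ranks are not yet known to be
  -- finite.
  have hbound : ∀ (n : ℕ) (t : Fin n → T), (∀ i, t i ∈ nontrivialIndices Γ) →
      (∀ i j, r (t i) (t j) → i = j) → ∀ k : Fin n → ℕ,
      (∀ i, (k i : ℕ∞) ≤ topRank (Γ (t i))) → ((∑ i, k i : ℕ) : ℕ∞) ≤ topRank G := by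
    intro n t ht hr k hk
    have hc : ∀ i, CompactSpace (Γ (t i)) := fun i =>
      isCompact_iff_compactSpace.mp (hcl (t i)).isCompact
    choose f hfo hfs using fun i => (hP (t i)).exists_surjective_elementary (k i) (hk i)
    obtain ⟨χ, hχ, hs⟩ := H n t ht hr _ f hfo hfs
    exact sum_le_topRank k χ hχ hs
  have hone : ∀ t ∈ nontrivialIndices Γ, 1 ≤ topRank (Γ t) := fun t ht => by
    have : Nontrivial (Γ t) := (Subgroup.nontrivial_iff_ne_bot _).mpr ht
    exact one_le_topRank
  obtain ⟨d, hd⟩ : ∃ d : ℕ, topRank G = d := by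
    obtain ⟨S, hS⟩ := hfg
    have : topRank G ≤ S.card := iInf₂_le S hS
    exact ENat.ne_top_iff_exists.mp (ne_top_of_le_ne_top (ENat.natCast_ne_top _) this) |>.imp
      fun _ h => h.symm
  have hcard : (Quotient.mk r '' nontrivialIndices Γ).encard ≤ topRank G := by
    by_contra! hlt
    rw [hd] at hlt
    -- Taking `d + 1` inequivalent indices with `k i = 1` would give `d + 1 ≤ d`.
    have hle : ((d + 1 : ℕ) : ℕ∞) ≤ (Quotient.mk r '' nontrivialIndices Γ).encard := by
      rw [Nat.cast_add, Nat.cast_one]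
      exact Order.add_one_le_of_lt hlt
    obtain ⟨Q, hQ, hQc⟩ := Set.exists_subset_encard_eq hle
    have hfin : Q.Finite := Set.finite_of_encard_eq_coe hQc
    have := hfin.to_subtype
    have hQn : Nat.card Q = d + 1 := by
      rw [Nat.card_coe_set_eq, Set.ncard, hQc]; rfl
    let e : Fin (d + 1) ≃ Q := (Finite.equivFinOfCardEq hQn).symm
    choose t ht hte using fun i => hQ (e i).2
    have h := hbound (d + 1) t ht (fun i j hij => e.injective (Subtype.ext (by
      rw [← hte i, ← hte j]; exact Quotient.sound hij))) (fun _ => 1)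
      (fun i => by simpa using hone _ (ht i))
    rw [hd] at h
    simp only [Finset.sum_const, Finset.card_univ, Fintype.card_fin, smul_eq_mul, mul_one] at h
    have : d + 1 ≤ d := by exact_mod_cast h
    omega
  refine ⟨?_, hcard, fun R hR hRr => ?_⟩
  · have hfin : (Quotient.mk r '' nontrivialIndices Γ).Finite := by
      rw [← Set.encard_lt_top_iff]
      exact lt_of_le_of_lt hcard (hd ▸ ENat.natCast_lt_top d)
    have heq : nontrivialIndices Γ =
        ⋃ q ∈ Quotient.mk r '' nontrivialIndices Γ, {s | Quotient.mk r s = q} := by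
      ext s
      simp only [Set.mem_iUnion]
      constructor
      · exact fun hs => ⟨_, ⟨s, hs, rfl⟩, rfl⟩
      · rintro ⟨_, ⟨t, ht, rfl⟩, hst⟩
        exact (hclass t ht).2 s (r.symm (Quotient.exact hst))
    rw [heq]
    refine hfin.isClosed_biUnion ?_
    rintro _ ⟨t, ht, rfl⟩
    convert (hclass t ht).1 using 1
    ext s
    exact ⟨fun h => r.symm (Quotient.exact h), fun h => Quotient.sound (r.symm h)⟩
  · let e : Fin R.card ≃ R := R.equivFin.symm
    have hr : ∀ i j, r (e i : T) (e j : T) → i = j := fun i j hij => by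
      obtain ⟨s, _, hu⟩ := hRr (e j) (hR (e j).2)
      have h1 := hu (e i) ⟨(e i).2, hij⟩
      have h2 := hu (e j) ⟨(e j).2, r.refl _⟩
      exact e.injective (Subtype.ext (h1.trans h2.symm))
    have hfin : ∀ i, ∃ m : ℕ, topRank (Γ (e i)) = m := by
      intro i
      refine (ENat.ne_top_iff_exists.mp fun htop => ?_).imp fun _ h => h.symm
      have h := hbound 1 (fun _ => e i) (fun _ => hR (e i).2)
        (fun _ _ _ => Subsingleton.elim _ _) (fun _ => d + 1) (fun _ => by rw [htop]; exact le_top)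
      rw [hd] at h
      simp only [Finset.univ_unique, Finset.sum_singleton] at h
      have : d + 1 ≤ d := by exact_mod_cast h
      omega
    choose k hk using hfin
    have h := hbound R.card (fun i => e i) (fun i => hR (e i).2) hr k (fun i => (hk i).ge)
    have hsum : ∑ t ∈ R, topRank (Γ t) = ∑ i, topRank (Γ (e i)) := by
      rw [← Finset.sum_coe_sort, ← e.sum_comp]
    rw [hsum, Finset.sum_congr rfl fun i _ => hk i]
    exact_mod_cast h

/-! ### Projective piles. -/

/-- Take a clopen neighbourhood `O` of `t` that misses the closed set of `N`-orbits of `P`. Its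
saturation `N • O` is open as a union of translates and closed as an image of the compact `N × O`.
-/
theorem exists_isClopen_invariant {T : Type v} [TopologicalSpace T] [CompactSpace T] [T2Space T]
    [TotallyDisconnectedSpace T] {N : Type u} [Group N] [TopologicalSpace N] [CompactSpace N]
    [MulAction N T] [ContinuousSMul N T] (t : T) {P : Set T} (hP : P.Finite)
    (ht : ∀ s ∈ P, s ∉ MulAction.orbit N t) :
    ∃ W : Set T, IsClopen W ∧ t ∈ W ∧ (∀ (n : N) (s : T), s ∈ W → n • s ∈ W) ∧
      ∀ s ∈ P, s ∉ W := by
  have hC : IsClosed (⋃ s ∈ P, MulAction.orbit N s) :=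
    hP.isClosed_biUnion fun s _ =>
      (isCompact_range (continuous_id.smul continuous_const : Continuous fun n : N => n • s)).isClosed
  obtain ⟨O, hO, htO, hOC⟩ := compact_exists_isClopen_in_isOpen hC.isOpen_compl
    (x := t) (by
      simp only [Set.mem_compl_iff, Set.mem_iUnion, not_exists]
      intro s hs hts
      exact ht s hs (MulAction.orbit_eq_iff.mpr hts ▸ MulAction.mem_orbit_self s))
  refine ⟨⋃ n : N, (fun s => n • s) '' O, ⟨?_, ?_⟩, ?_, ?_, ?_⟩
  · have h : (⋃ n : N, (fun s => n • s) '' O) =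
        (fun x : N × T => x.1 • x.2) '' (Set.univ ×ˢ O) := by
      ext s
      simp [Set.mem_smul]
    rw [h]
    exact ((isCompact_univ.prod hO.isClosed.isCompact).image continuous_smul).isClosed
  · exact isOpen_iUnion fun n => isOpenMap_smul n O hO.isOpen
  · exact Set.mem_iUnion.mpr ⟨1, t, htO, one_smul _ _⟩
  · intro n s hs
    obtain ⟨m, x, hx, rfl⟩ := Set.mem_iUnion.mp hs
    exact Set.mem_iUnion.mpr ⟨n * m, x, hx, mul_smul _ _ _⟩
  · intro s hs hsW
    obtain ⟨m, x, hx, rfl⟩ := Set.mem_iUnion.mp hsW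
    refine hOC hx (Set.mem_biUnion hs ?_)
    exact ⟨m⁻¹, by simp⟩

/-- A morphism from a pile to a finite pile which separates the orbits of finitely many points
and preserves their stabilizers modulo a given open normal subgroup. -/
theorem exists_pileHom_separating {G : Type u} [Group G] [TopologicalSpace G]
    [IsTopologicalGroup G] [CompactSpace G]
    (hsol : IsProsoluble G) {T : Type v} [TopologicalSpace T] [CompactSpace T] [T2Space T]
    [TotallyDisconnectedSpace T] [MulAction G T] [ContinuousSMul G T]
    {n : ℕ} (t : Fin n → T) (hr : ∀ i j, MulAction.orbitRel G T (t i) (t j) → i = j)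
    (N : OpenNormalSubgroup G) :
    ∃ (A X : Type) (_ : Group A) (_ : Finite A) (_ : Finite X)
      (_ : TopologicalSpace A) (_ : DiscreteTopology A) (_ : TopologicalSpace X)
      (_ : DiscreteTopology X) (_ : MulAction A X) (φ : PileHom G T A X),
      Group.IsSolvable A ∧ φ.hom.ker = (N : Subgroup G) ∧
      (∀ i j, φ.map (t i) ∈ MulAction.orbit A (φ.map (t j)) → i = j) ∧
      ∀ i (a : A), a • φ.map (t i) = φ.map (t i) →
        ∃ g ∈ MulAction.stabilizer G (t i), φ.hom g = a := by
  obtain ⟨A, _, _, φ, hA, hφ, hker⟩ := exists_finite_quotient hsol N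
  have hNc : CompactSpace (N : Subgroup G) :=
    isCompact_iff_compactSpace.mp ((N : Subgroup G).isClosed_of_isOpen N.isOpen').isCompact
  let σ : A → G := Function.surjInv hφ
  have hσ : ∀ a, φ (σ a) = a := Function.surjInv_eq hφ
  have hmem : ∀ g : G, φ g = 1 → g ∈ (N : Subgroup G) := fun g hg => by
    rw [← hker]; exact hg
  have hW : ∀ i, ∃ W : Set T, IsClopen W ∧ t i ∈ W ∧
      (∀ (n : (N : Subgroup G)) (s : T), s ∈ W → n • s ∈ W) ∧
      ∀ j (g : G), g • t j ∈ W → g • t j ∈ MulAction.orbit (N : Subgroup G) (t i) := by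
    intro i
    -- Modulo `N` the translates of the `t j` are represented by finitely many points `σ a • t j`;
    -- `W` has to avoid those outside the `N`-orbit of `t i`.
    let P : Set T := (Set.range fun x : A × Fin n => σ x.1 • t x.2) \
      MulAction.orbit (N : Subgroup G) (t i)
    obtain ⟨W, hW, hti, hinv, hP⟩ := exists_isClopen_invariant (N := (N : Subgroup G)) (t i)
      (P := P) ((Set.finite_range _).sdiff) (fun s hs => hs.2)
    refine ⟨W, hW, hti, hinv, fun j g hg => ?_⟩
    let m : (N : Subgroup G) := ⟨σ (φ g) * g⁻¹, hmem _ (by rw [map_mul, hσ, map_inv, mul_inv_cancel])⟩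
    have hm : m • (g • t j) = σ (φ g) • t j := by
      change (σ (φ g) * g⁻¹) • (g • t j) = _
      rw [smul_smul, inv_mul_cancel_right]
    have h1 : σ (φ g) • t j ∈ MulAction.orbit (N : Subgroup G) (t i) := by
      by_contra hno
      refine hP _ ⟨⟨(φ g, j), rfl⟩, hno⟩ ?_
      have := hinv m _ hg
      rwa [hm] at this
    rw [← hm, ← MulAction.orbit_eq_iff, MulAction.orbit_smul] at h1
    exact MulAction.orbit_eq_iff.mp h1
  choose W hWc hWt hWinv hWsep using hW
  have hWiff : ∀ i (g h : G) (s : T), φ g = φ h → (g⁻¹ • s ∈ W i ↔ h⁻¹ • s ∈ W i) := by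
    have key : ∀ i (g h : G) (s : T), φ g = φ h → g⁻¹ • s ∈ W i → h⁻¹ • s ∈ W i := by
      intro i g h s hgh hs
      have := hWinv i ⟨h⁻¹ * g, hmem _ (by rw [map_mul, map_inv, hgh, inv_mul_cancel])⟩ _ hs
      change (h⁻¹ * g) • (g⁻¹ • s) ∈ W i at this
      rwa [smul_smul, mul_inv_cancel_right] at this
    exact fun i g h s hgh => ⟨key i g h s hgh, key i h g s hgh.symm⟩
  -- A point `s` is recorded by which `(σ a)⁻¹ • s` lie in which `W i`. Invariance of `W i` under
  -- `N` makes this independent of the section `σ`, hence equivariant.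
  let X := A → Fin n → Bool
  let _ : MulAction A X := arrowAction
  let _ : TopologicalSpace A := ⊥
  have : DiscreteTopology A := ⟨rfl⟩
  let Φ : PileHom G T A X :=
    { hom := φ
      map := fun s a i => (W i).boolIndicator ((σ a)⁻¹ • s)
      continuous_hom := continuous_of_isOpen_ker φ (by rw [hker]; exact N.isOpen')
      continuous_map := by
        refine continuous_pi fun a => continuous_pi fun i => ?_
        exact ((continuous_boolIndicator_iff_isClopen _).mpr (hWc i)).comp (continuous_const_smul _)
      map_smul := fun g s => by
        funext a i
        change (W i).boolIndicator ((σ a)⁻¹ • g • s) =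
          (W i).boolIndicator ((σ ((φ g)⁻¹ * a))⁻¹ • s)
        have h1 : (σ a)⁻¹ • g • s ∈ W i ↔ (σ ((φ g)⁻¹ * a))⁻¹ • s ∈ W i := by
          rw [hWiff i (σ ((φ g)⁻¹ * a)) (g⁻¹ * σ a) s (by simp [hσ]), smul_smul]
          simp
        rw [Bool.eq_iff_iff, ← Set.mem_iff_boolIndicator, ← Set.mem_iff_boolIndicator]
        exact h1 }
  have horb : ∀ i j (g : G), Φ.map (g • t j) = Φ.map (t i) →
      g • t j ∈ MulAction.orbit (N : Subgroup G) (t i) := by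
    intro i j g h
    have h1 := congrFun (congrFun h 1) i
    change (W i).boolIndicator ((σ 1)⁻¹ • g • t j) = (W i).boolIndicator ((σ 1)⁻¹ • t i) at h1
    rw [Bool.eq_iff_iff, ← Set.mem_iff_boolIndicator, ← Set.mem_iff_boolIndicator,
      hWiff i (σ 1) 1 _ (by simp [hσ]), hWiff i (σ 1) 1 _ (by simp [hσ])] at h1
    simp only [inv_one, one_smul] at h1
    exact hWsep i j g (h1.mpr (hWt i))
  refine ⟨A, X, inferInstance, inferInstance, inferInstance, inferInstance, inferInstance,
    inferInstance, inferInstance, inferInstance, Φ, hA, hker, ?_, ?_⟩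
  · rintro i j ⟨a, ha⟩
    obtain ⟨g, rfl⟩ := hφ a
    obtain ⟨m, hm⟩ := horb i j g ((Φ.map_smul g (t j)).trans ha)
    refine hr i j ?_
    rw [MulAction.orbitRel_apply]
    refine ⟨(m : G)⁻¹ * g, ?_⟩
    change ((m : G)⁻¹ * g) • t j = t i
    rw [mul_smul, ← hm]
    change (m : G)⁻¹ • (m : G) • t i = t i
    rw [inv_smul_smul]
  · intro i a ha
    obtain ⟨g, rfl⟩ := hφ a
    obtain ⟨m, hm⟩ := horb i i g ((Φ.map_smul g (t i)).trans ha)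
    change (m : G) • t i = g • t i at hm
    refine ⟨(m : G)⁻¹ * g, ?_, ?_⟩
    · rw [MulAction.mem_stabilizer_iff, mul_smul, ← hm, inv_smul_smul]
    · have : φ (m : G) = 1 := by
        change (m : G) ∈ φ.ker
        rw [hker]
        exact m.2
      change φ _ = φ g
      rw [map_mul, map_inv, this, inv_one, one_mul]

/-- Homomorphisms on the stabilizers of points in distinct orbits, with values in abelian groups,
are the restrictions of a cocycle on the whole action. -/
theorem exists_cocycle {A X : Type*} [Group A] [MulAction A X] {ι : Type*}
    (x : ι → X) {V : ι → Type*} [∀ i, CommGroup (V i)] (F : ∀ i, A → V i)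
    (hx : ∀ i j, x i ∈ MulAction.orbit A (x j) → i = j)
    (hF : ∀ i a b, a • x i = x i → b • x i = x i → F i (a * b) = F i a * F i b) :
    ∃ c : A → X → ∀ i, V i, (∀ a b y, c (a * b) y = c a (b • y) * c b y) ∧
      ∀ i a, a • x i = x i → c a (x i) i = F i a ∧ ∀ j ≠ i, c a (x i) j = 1 := by
  classical
  have hs : ∀ i y, ∃ s : A, y ∈ MulAction.orbit A (x i) → s • x i = y := by
    intro i y
    by_cases h : y ∈ MulAction.orbit A (x i)
    · obtain ⟨s, hs⟩ := h
      exact ⟨s, fun _ => hs⟩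
    · exact ⟨1, fun h' => absurd h' h⟩
  -- `s i y` transports `x i` to `y`, so `(s i (a • y))⁻¹ * a * s i y` fixes `x i`. The cocycle is
  -- `F i` of this element, and `1` off the orbit.
  choose s hs using hs
  have hst : ∀ i a y, y ∈ MulAction.orbit A (x i) →
      ((s i (a • y))⁻¹ * a * s i y) • x i = x i := by
    intro i a y hy
    have h1 : a • y ∈ MulAction.orbit A (x i) := by
      rw [← MulAction.orbit_eq_iff, MulAction.orbit_smul]; exact MulAction.orbit_eq_iff.mpr hy
    rw [mul_smul, hs i y hy, mul_smul, inv_smul_eq_iff, hs i (a • y) h1]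
  have hinv : ∀ i (a : A), a • x i = x i → a⁻¹ • x i = x i := fun i a ha => by
    rw [inv_smul_eq_iff, ha]
  have hone : ∀ i, F i 1 = 1 := fun i => by
    have := hF i 1 1 (one_smul _ _) (one_smul _ _)
    rw [mul_one] at this
    exact left_eq_mul.mp this
  have hFinv : ∀ i (a : A), a • x i = x i → F i a⁻¹ = (F i a)⁻¹ := fun i a ha => by
    rw [eq_inv_iff_mul_eq_one, ← hF i _ _ (hinv i a ha) ha, inv_mul_cancel, hone]
  refine ⟨fun a y i => if y ∈ MulAction.orbit A (x i) then F i ((s i (a • y))⁻¹ * a * s i y) else 1,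
    fun a b y => ?_, fun i a ha => ⟨?_, fun j hj => ?_⟩⟩
  · funext i
    have hiff : b • y ∈ MulAction.orbit A (x i) ↔ y ∈ MulAction.orbit A (x i) := by
      rw [← MulAction.orbit_eq_iff, MulAction.orbit_smul, MulAction.orbit_eq_iff]
    simp only [Pi.mul_apply, hiff]
    split_ifs with h
    · rw [← hF i _ _ (hst i a _ (hiff.mpr h)) (hst i b y h), smul_smul]
      congr 1
      group
    · simp
  · have hself : x i ∈ MulAction.orbit A (x i) := MulAction.mem_orbit_self _
    have h1 := hs i _ hself
    simp only [hself, if_true, ha]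
    rw [hF i _ _ (by rw [mul_smul, ha, hinv i _ h1]) h1, hF i _ _ (hinv i _ h1) ha, hFinv i _ h1]
    -- The transporter `s i (x i)` need not be `1`, but it cancels because `V i` is abelian.
    rw [mul_comm, mul_inv_cancel_left]
  · have : x i ∉ MulAction.orbit A (x j) := fun h => hj (hx i j h).symm
    simp only [this, if_false]

/-- The action of `A × V` on `X × V` twisted by a cocycle. -/
abbrev cocycleAction {A X V : Type*} [Group A] [MulAction A X] [CommGroup V] (c : A → X → V)
    (hc : ∀ a b y, c (a * b) y = c a (b • y) * c b y) : MulAction (A × V) (X × V) where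
  smul b y := (b.1 • y.1, b.2 * c b.1 y.1 * y.2)
  one_smul y := by
    have h := hc 1 1 y.1
    rw [mul_one, one_smul] at h
    change (((1 : A) • y.1, (1 : V) * c 1 y.1 * y.2) : X × V) = y
    rw [left_eq_mul.mp h, one_smul, mul_one, one_mul]
  mul_smul a b y := by
    change (((a.1 * b.1) • y.1, (a.2 * b.2) * c (a.1 * b.1) y.1 * y.2) : X × V) =
      (a.1 • b.1 • y.1, a.2 * c a.1 (b.1 • y.1) * (b.2 * c b.1 y.1 * y.2))
    rw [hc, mul_smul]
    congr 1
    simp only [mul_assoc, mul_left_comm, mul_comm]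

/-- In the twisted action the stabilizer of `(x, v)` is the graph of `a ↦ (c a x)⁻¹` over the
stabilizer of `x`, and `V` permutes each fibre transitively, so the projection to `(A, X)` is a
rigid epimorphism. A solution sends stabilizers into these graphs, and `χ` is its `V`-component. -/
theorem IsSProjectivePile.exists_hom_of_cocycle {G : Type u} {T : Type v} [Group G]
    [TopologicalSpace G] [TopologicalSpace T] [MulAction G T] (h : IsSProjectivePile G T)
    {A X V : Type} [Group A] [Finite A] [Finite X] [TopologicalSpace A] [DiscreteTopology A]
    [TopologicalSpace X] [DiscreteTopology X] [MulAction A X] [CommGroup V] [Finite V]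
    (hA : Group.IsSolvable A) (φ : PileHom G T A X) (c : A → X → V)
    (hc : ∀ a b y, c (a * b) y = c a (b • y) * c b y) :
    ∃ χ : G →* V, IsOpen (χ.ker : Set G) ∧
      ∀ t, ∀ g ∈ MulAction.stabilizer G t, χ g * c (φ.hom g) (φ.map t) = 1 := by
  let _ : MulAction (A × V) (X × V) := cocycleAction c hc
  let _ : TopologicalSpace V := ⊥
  have : DiscreteTopology V := ⟨rfl⟩
  have hsmul : ∀ (b : A × V) (y : X × V), b • y = (b.1 • y.1, b.2 * c b.1 y.1 * y.2) :=
    fun _ _ => rfl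
  let α : PileHom (A × V) (X × V) A X :=
    { hom := MonoidHom.fst A V
      map := Prod.fst
      continuous_hom := continuous_fst
      continuous_map := continuous_fst
      map_smul := fun _ _ => rfl }
  have hstab : ∀ (b : A × V) (y : X × V),
      b ∈ MulAction.stabilizer (A × V) y ↔ b.1 • y.1 = y.1 ∧ b.2 * c b.1 y.1 = 1 := by
    intro b y
    rw [MulAction.mem_stabilizer_iff, hsmul, Prod.ext_iff]
    simp
  have hbij : ∀ y : X × V, Set.BijOn α.hom (MulAction.stabilizer (A × V) y : Set (A × V))
      (MulAction.stabilizer A (α.map y) : Set A) := by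
    intro y
    refine ⟨fun b hb => ((hstab b y).mp hb).1, fun b hb b' hb' hbb => ?_, fun a ha => ?_⟩
    · have h1 : b.1 = b'.1 := hbb
      have h2 := ((hstab b y).mp hb).2
      have h3 := ((hstab b' y).mp hb').2
      rw [← h1, ← h2] at h3
      exact Prod.ext h1 (mul_right_cancel h3).symm
    · exact ⟨(a, (c a y.1)⁻¹), (hstab _ y).mpr ⟨ha, inv_mul_cancel _⟩, rfl⟩
  have hepi : α.IsEpi :=
    { surj_hom := fun a => ⟨(a, 1), rfl⟩
      surj_map := fun x => ⟨(x, 1), rfl⟩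
      exists_stab := fun x => ⟨(x, 1), rfl, SetLike.coe_injective (hbij (x, 1)).image_eq⟩ }
  have horb : IsHomeomorph α.orbitMap := by
    have hbij : Function.Bijective α.orbitMap := by
      constructor
      · rintro ⟨y⟩ ⟨z⟩ hyz
        obtain ⟨a, ha⟩ := Quotient.exact hyz
        refine Quotient.sound ⟨(a, y.2 * z.2⁻¹ * (c a z.1)⁻¹), ?_⟩
        change ((a • z.1, y.2 * z.2⁻¹ * (c a z.1)⁻¹ * c a z.1 * z.2) : X × V) = y
        exact Prod.ext ha (by simp)
      · rintro ⟨x⟩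
        exact ⟨Quotient.mk _ (x, 1), rfl⟩
    have hd1 : DiscreteTopology (MulAction.orbitRel.Quotient (A × V) (X × V)) :=
      discreteTopology_iff_forall_isOpen.mpr fun s => isOpen_coinduced.mpr (isOpen_discrete _)
    have hd2 : DiscreteTopology (MulAction.orbitRel.Quotient A X) :=
      discreteTopology_iff_forall_isOpen.mpr fun s => isOpen_coinduced.mpr (isOpen_discrete _)
    exact ⟨continuous_of_discreteTopology, fun s _ => isOpen_discrete _, hbij⟩
  have hB : Group.IsSolvable (A × V) := inferInstance
  obtain ⟨γ, hγ, hγm⟩ := h A X (A × V) (X × V) φ α hB hepi ⟨hbij, horb⟩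
  refine ⟨(MonoidHom.snd A V).comp γ.hom, isOpen_ker_of_continuous _
    (continuous_snd.comp γ.continuous_hom), fun t g hg => ?_⟩
  have h1 : γ.hom g ∈ MulAction.stabilizer (A × V) (γ.map t) := by
    rw [MulAction.mem_stabilizer_iff, ← γ.map_smul, MulAction.mem_stabilizer_iff.mp hg]
  have h2 := ((hstab _ _).mp h1).2
  have h3 : (γ.hom g).1 = φ.hom g := hγ g
  have h4 : (γ.map t).1 = φ.map t := hγm t
  rw [h3, h4] at h2
  exact h2

theorem IsSProjectivePile.exists_surjective {G : Type u} [Group G] [TopologicalSpace G]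
    [IsTopologicalGroup G] [CompactSpace G] [T2Space G] [TotallyDisconnectedSpace G]
    (hsol : IsProsoluble G) {T : Type v} [TopologicalSpace T] [CompactSpace T] [T2Space T]
    [TotallyDisconnectedSpace T] [MulAction G T] [ContinuousSMul G T] (h : IsSProjectivePile G T)
    {n : ℕ} (t : Fin n → T) (hr : ∀ i j, MulAction.orbitRel G T (t i) (t j) → i = j)
    {V : Fin n → Type} [∀ i, CommGroup (V i)] [∀ i, Finite (V i)]
    (f : ∀ i, MulAction.stabilizer G (t i) →* V i)
    (hf : ∀ i, IsOpen ((f i).ker : Set (MulAction.stabilizer G (t i))))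
    (hs : ∀ i, Function.Surjective (f i)) :
    ∃ χ : G →* ∀ i, V i, IsOpen (χ.ker : Set G) ∧ Function.Surjective χ := by
  obtain ⟨M, -⟩ := ProfiniteGrp.exist_openNormalSubgroup_sub_open_nhds_of_one
    (isOpen_univ : IsOpen (Set.univ : Set G)) trivial
  obtain ⟨N, -, hN⟩ := exists_openNormalSubgroup_forall_le
    (fun i (N : OpenNormalSubgroup G) => ∀ x : MulAction.stabilizer G (t i), (x : G) ∈ N → f i x = 1)
    (fun i N N' hle hN x hx => hN x (hle hx))
    (fun i => exists_openNormalSubgroup_ker (f i) (hf i)) M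
  obtain ⟨A, X, _, _, _, _, _, _, _, _, φ, hA, hker, horb, hstab⟩ :=
    exists_pileHom_separating hsol t hr N
  choose F hF using fun i => exists_factor φ.hom (f i) fun x hx => hN i x (by
    have : (x : G) ∈ φ.hom.ker := hx
    rw [hker] at this
    exact this)
  -- `F i` is only a map of sets; it is multiplicative on the stabilizer of `φ.map (t i)` because
  -- that stabilizer lifts to the stabilizer of `t i`.
  obtain ⟨c, hc, hcF⟩ := exists_cocycle (fun i => φ.map (t i)) F horb (fun i a b ha hb => by
    obtain ⟨g, hg, rfl⟩ := hstab i a ha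
    obtain ⟨k, hk, rfl⟩ := hstab i b hb
    have h1 := hF i (⟨g, hg⟩ * ⟨k, hk⟩)
    rw [map_mul, ← hF i, ← hF i] at h1
    simpa using h1)
  obtain ⟨χ, hχ, hχc⟩ := h.exists_hom_of_cocycle hA φ c hc
  refine ⟨χ, hχ, surjective_of_mulSingle χ fun i v => ?_⟩
  -- The inverse appears because `χ` is the inverse of the cocycle on stabilizers.
  obtain ⟨g, hg⟩ := hs i v⁻¹
  refine ⟨g, ?_⟩
  have hfix : φ.hom (g : G) • φ.map (t i) = φ.map (t i) := by
    rw [← φ.map_smul, MulAction.mem_stabilizer_iff.mp g.2]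
  obtain ⟨h1, h2⟩ := hcF i _ hfix
  rw [eq_inv_of_mul_eq_one_left (hχc (t i) g g.2)]
  funext j
  rw [Pi.inv_apply]
  rcases eq_or_ne j i with rfl | hj
  · rw [h1, hF, hg, inv_inv, Pi.mulSingle_eq_same]
  · rw [h2 j hj, inv_one, Pi.mulSingle_eq_of_ne hj]

theorem IsSProjectivePile.generatorBound {G : Type u} [Group G] [TopologicalSpace G]
    [IsTopologicalGroup G] [CompactSpace G] [T2Space G] [TotallyDisconnectedSpace G]
    (hsol : IsProsoluble G) (hfg : ∃ S : Finset G, TopGenerates G (S : Set G))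
    {p : ℕ} [Fact p.Prime] {T : Type v} [TopologicalSpace T] [CompactSpace T] [T2Space T]
    [TotallyDisconnectedSpace T] [MulAction G T] [ContinuousSMul G T] (h : IsSProjectivePile G T)
    (hP : ∀ t : T, IsProP p (MulAction.stabilizer G t)) :
    GeneratorBound (MulAction.orbitRel G T) (fun t : T => MulAction.stabilizer G t) := by
  have hcont : ∀ t : T, Continuous fun g : G => g • t := fun t =>
    continuous_id.smul continuous_const
  refine generatorBound_of_surjective hfg _ _ (fun t => ?_) hP (fun t ht => ⟨?_, fun s hts => ?_⟩)
    (fun n t _ hr V _ _ f hf hs => h.exists_surjective hsol t hr f hf hs)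
  · exact isClosed_singleton.preimage (hcont t)
  · have : {s | MulAction.orbitRel G T t s} = MulAction.orbit G t := by
      ext s
      exact MulAction.orbitRel_apply.trans MulAction.mem_orbit_symm
    rw [this]
    exact (isCompact_range (hcont t)).isClosed
  · obtain ⟨g, rfl⟩ := hts
    intro hs
    apply ht
    change MulAction.stabilizer G (g • s) = ⊥
    rw [MulAction.stabilizer_smul_eq_stabilizer_map_conj,
      show MulAction.stabilizer G s = ⊥ from hs, Subgroup.map_bot]

/-! ### Projectivity relative to a continuous family. -/

theorem Subgroup.mem_map_conj {G : Type*} [Group G] {H : Subgroup G} {g x : G} :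
    x ∈ H.map (MulAut.conj g).toMonoidHom ↔ g⁻¹ * x * g ∈ H := by
  constructor
  · rintro ⟨y, hy, rfl⟩
    simpa [mul_assoc] using hy
  · exact fun h => ⟨_, h, by simp [mul_assoc]⟩

theorem Subgroup.map_conj_map_conj {G : Type*} [Group G] (H : Subgroup G) (a b : G) :
    (H.map (MulAut.conj a).toMonoidHom).map (MulAut.conj b).toMonoidHom =
      H.map (MulAut.conj (b * a)).toMonoidHom := by
  ext x
  simp only [Subgroup.mem_map_conj, mul_inv_rev, mul_assoc]

theorem Subgroup.map_conj_map {G A : Type*} [Group G] [Group A] (H : Subgroup G) (φ : G →* A)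
    (g : G) : (H.map (MulAut.conj g).toMonoidHom).map φ =
      (H.map φ).map (MulAut.conj (φ g)).toMonoidHom := by
  rw [Subgroup.map_map, Subgroup.map_map]
  congr 1
  ext x
  simp

theorem Subgroup.map_conj_sup_eq_of_mem {G : Type*} [Group G] (H N : Subgroup G) [N.Normal]
    {g k : G} (h : g⁻¹ * k ∈ N) :
    H.map (MulAut.conj k).toMonoidHom ⊔ N = H.map (MulAut.conj g).toMonoidHom ⊔ N := by
  have hgk : QuotientGroup.mk' N k = QuotientGroup.mk' N g := (QuotientGroup.eq.mpr h).symm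
  have key : ∀ K : Subgroup G, K ⊔ N = (K.map (QuotientGroup.mk' N)).comap (QuotientGroup.mk' N) :=
    fun K => by rw [Subgroup.comap_map_eq, QuotientGroup.ker_mk']
  rw [key, key, Subgroup.map_conj_map, Subgroup.map_conj_map, hgk]

theorem OpenNormalSubgroup.sup_le_sup_left {G : Type u} [Group G] [TopologicalSpace G]
    {N N' : OpenNormalSubgroup G} (h : N' ≤ N) (H : Subgroup G) :
    H ⊔ (N' : Subgroup G) ≤ H ⊔ (N : Subgroup G) := by
  have h' : (N' : Subgroup G) ≤ (N : Subgroup G) := fun _ hx => h hx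
  exact _root_.sup_le_sup_left h' H

/-- For one conjugator `g`, some element of `H` is separated from the closed conjugate of `K` modulo
some `N`. The same `N` serves the whole coset of `g`, and compactness of `G` makes the choice
uniform. -/
theorem exists_openNormalSubgroup_conj_le {G : Type u} [Group G] [TopologicalSpace G]
    [IsTopologicalGroup G] [CompactSpace G] [T2Space G] [TotallyDisconnectedSpace G]
    {H K : Subgroup G} (hK : IsClosed (K : Set G))
    (h : ∀ g : G, ¬ H ≤ K.map (MulAut.conj g).toMonoidHom) (M : OpenNormalSubgroup G) :
    ∃ N ≤ M, ∀ g : G, ¬ H ≤ K.map (MulAut.conj g).toMonoidHom ⊔ (N : Subgroup G) := by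
  refine exists_openNormalSubgroup_forall (G := G) (K := G)
    (fun g (N : OpenNormalSubgroup G) => ¬ H ≤ K.map (MulAut.conj g).toMonoidHom ⊔ (N : Subgroup G))
    (fun g N N' hle hN hN' => ?_) (fun g => ?_) M
  · exact hN (hN'.trans (OpenNormalSubgroup.sup_le_sup_left hle _))
  obtain ⟨x, hx, hxK⟩ := SetLike.not_le_iff_exists.mp (h g)
  have hcl : IsClosed (K.map (MulAut.conj g).toMonoidHom : Set G) := by
    have : (K.map (MulAut.conj g).toMonoidHom : Set G) = (fun x => g⁻¹ * x * g) ⁻¹' K :=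
      Set.ext fun x => Subgroup.mem_map_conj
    rw [this]
    exact hK.preimage (by fun_prop)
  obtain ⟨N, hN⟩ := exists_openNormalSubgroup_notMem_sup hcl hxK
  refine ⟨N, ?_⟩
  have hnhds : {k | g⁻¹ * k ∈ N} ∈ nhds g :=
    (N.isOpen'.preimage (continuous_const_mul g⁻¹)).mem_nhds (by simp)
  filter_upwards [hnhds] with k hk hle
  rw [Subgroup.map_conj_sup_eq_of_mem K (N : Subgroup G) hk] at hle
  exact hN (hle hx)

/-- Compactness of `T`: if `Γ t` is not contained in `Γ s`, this is visible modulo some `N` and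
persists near `s`. Otherwise `s = t`, and continuity of the family gives the conclusion near `t`. -/
theorem IsContinuousFamily.exists_openNormalSubgroup {G : Type u} [Group G] [TopologicalSpace G]
    [IsTopologicalGroup G] [CompactSpace G] [T2Space G] [TotallyDisconnectedSpace G]
    {T : Type v} [TopologicalSpace T] [CompactSpace T] {Γ : T → Subgroup G}
    (hΓ : IsContinuousFamily Γ) (hinj : ∀ s t : T, Γ s ≠ ⊥ → Γ s ≤ Γ t → s = t)
    {t : T} (ht : Γ t ≠ ⊥) (M : OpenNormalSubgroup G) :
    ∃ N ≤ M, ∀ s, Γ t ≤ Γ s ⊔ (N : Subgroup G) → Γ s ≤ Γ t ⊔ (M : Subgroup G) := by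
  refine exists_openNormalSubgroup_forall
    (fun s (N : OpenNormalSubgroup G) => Γ t ≤ Γ s ⊔ (N : Subgroup G) → Γ s ≤ Γ t ⊔ (M : Subgroup G))
    (fun s N N' hle hN hN' => hN (hN'.trans (OpenNormalSubgroup.sup_le_sup_left hle _))) (fun s => ?_) M
  by_cases hts : Γ t ≤ Γ s
  · obtain rfl := hinj t s ht hts
    refine ⟨M, ?_⟩
    have ho := hΓ.isOpen_le (Γ t ⊔ (M : Subgroup G))
      (Subgroup.isOpen_mono (H₁ := (M : Subgroup G)) le_sup_right M.isOpen')
    filter_upwards [ho.mem_nhds (le_sup_left : Γ t ≤ Γ t ⊔ (M : Subgroup G))] with s hs _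
    exact hs
  · obtain ⟨x, hx, hxs⟩ := SetLike.not_le_iff_exists.mp hts
    obtain ⟨N, hN⟩ := exists_openNormalSubgroup_notMem_sup (hΓ.isClosed s) hxs
    refine ⟨N, ?_⟩
    have ho := hΓ.isOpen_le (Γ s ⊔ (N : Subgroup G))
      (Subgroup.isOpen_mono (H₁ := (N : Subgroup G)) le_sup_right N.isOpen')
    filter_upwards [ho.mem_nhds (le_sup_left : Γ s ≤ Γ s ⊔ (N : Subgroup G))] with s' hs' hle
    exact absurd ((hle.trans (sup_le hs' le_sup_right)) hx) hN

/-- The conjugacy class of an indexed closed subgroup is closed in the index space. -/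
theorem IsContinuousFamily.isClosed_conj {G : Type u} [Group G] [TopologicalSpace G]
    [IsTopologicalGroup G] [CompactSpace G] [T2Space G] [TotallyDisconnectedSpace G]
    {T : Type v} [TopologicalSpace T] {Γ : T → Subgroup G} (hΓ : IsContinuousFamily Γ)
    (H : Subgroup G) : IsClosed {s | ∃ g : G, H.map (MulAut.conj g).toMonoidHom ≤ Γ s} := by
  have h : {s | ∃ g : G, H.map (MulAut.conj g).toMonoidHom ≤ Γ s} =
      Prod.snd '' {x : G × T | H.map (MulAut.conj x.1).toMonoidHom ≤ Γ x.2} := by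
    ext s; simp
  rw [h]
  -- Projection along the compact `G` is closed. Non-containment is open in the pair `(g, s)`, as an
  -- element outside `Γ s` stays outside modulo some `N`.
  refine isClosedMap_snd_of_compactSpace _ (isOpen_compl_iff.mp (isOpen_iff_mem_nhds.mpr ?_))
  rintro ⟨g, s⟩ (hgs : ¬ H.map (MulAut.conj g).toMonoidHom ≤ Γ s)
  obtain ⟨_, ⟨x, hx, rfl⟩, hxs⟩ := SetLike.not_le_iff_exists.mp hgs
  obtain ⟨N, hN⟩ := exists_openNormalSubgroup_notMem_sup (hΓ.isClosed s) hxs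
  have hU : IsOpen ((Γ s ⊔ (N : Subgroup G) : Subgroup G) : Set G) :=
    Subgroup.isOpen_mono (H₁ := (N : Subgroup G)) le_sup_right N.isOpen'
  have hV : IsOpen {k : G | k * x * k⁻¹ ∉ Γ s ⊔ (N : Subgroup G)} :=
    ((Subgroup.isClosed_of_isOpen _ hU).isOpen_compl).preimage
      (by fun_prop : Continuous fun k : G => k * x * k⁻¹)
  filter_upwards [prod_mem_nhds (hV.mem_nhds (show g ∈ _ from hN))
    ((hΓ.isOpen_le _ hU).mem_nhds (le_sup_left : Γ s ≤ Γ s ⊔ (N : Subgroup G)))] with y hy hle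
  exact hy.1 (hy.2 (hle ⟨x, hx, rfl⟩))

/-- Solution of the embedding problem for `A × V` whose subgroups are the conjugates of the graphs
of homomorphisms `F i : D i →* V`, and all subgroups of `A` of a conjugation-closed
class `small`. -/
theorem IsSProjectiveRel.exists_hom {G : Type u} [Group G] [TopologicalSpace G]
    [IsTopologicalGroup G] {𝒢 : Set (Subgroup G)} (hproj : IsSProjectiveRel G 𝒢)
    {A V : Type} [Group A] [Finite A] [CommGroup V] [Finite V] (hA : Group.IsSolvable A)
    (φ : G →* A) (hφ : IsOpen (φ.ker : Set G)) {ι : Type*} (D : ι → Subgroup A)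
    (F : ∀ i, D i →* V) (small : Subgroup A → Prop)
    (mono : ∀ K L, K ≤ L → small L → small K)
    (conj : ∀ K a, small K → small (K.map (MulAut.conj a).toMonoidHom))
    (h : ∀ H ∈ 𝒢, (∃ i a, ∀ x ∈ H, a⁻¹ * φ x * a ∈ D i) ∨ small (H.map φ)) :
    ∃ χ : G →* V, IsOpen (χ.ker : Set G) ∧ ∀ H ∈ 𝒢,
      (∃ i a, ∀ x ∈ H, ∃ hx : a⁻¹ * φ x * a ∈ D i, χ x = F i ⟨_, hx⟩) ∨ small (H.map φ) := by
  let _ : TopologicalSpace V := ⊥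
  have : DiscreteTopology V := ⟨rfl⟩
  let _ : TopologicalSpace A := ⊥
  have : DiscreteTopology A := ⟨rfl⟩
  let graph : ι → Subgroup (A × V) := fun i => ((D i).subtype.prod (F i)).range
  have hgraph : ∀ i (b : A × V), b ∈ graph i ↔ ∃ hb : b.1 ∈ D i, F i ⟨b.1, hb⟩ = b.2 := by
    intro i b
    constructor
    · rintro ⟨d, rfl⟩
      exact ⟨d.2, rfl⟩
    · rintro ⟨hb, h⟩
      exact ⟨⟨b.1, hb⟩, Prod.ext rfl h⟩
  let ℬ : Set (Subgroup (A × V)) :=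
    {E | (∃ i b, E = (graph i).map (MulAut.conj b).toMonoidHom) ∨ small (E.map (MonoidHom.fst A V))}
  have hℬ : ConjClosed ℬ := by
    rintro E (⟨i, b, rfl⟩ | hE) g _ rfl
    · exact Or.inl ⟨i, g * b, Subgroup.map_conj_map_conj _ _ _⟩
    · refine Or.inr ?_
      rw [Subgroup.map_conj_map]
      exact conj _ _ hE
  let 𝒜 : Set (Subgroup A) := (fun E : Subgroup (A × V) => E.map (MonoidHom.fst A V)) '' ℬ
  have h𝒜 : ConjClosed 𝒜 := by
    rintro _ ⟨E, hE, rfl⟩ a _ rfl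
    refine ⟨_, hℬ E hE (a, 1) _ rfl, ?_⟩
    exact Subgroup.map_conj_map _ _ _
  have hloc : ∀ H ∈ 𝒢, ∃ E ∈ ℬ, ∃ l : ↥H →* A × V,
      Continuous l ∧ (∀ x, l x ∈ E) ∧ ∀ x : ↥H, (MonoidHom.fst A V) (l x) = φ (x : G) := by
    intro H hH
    have hφc := continuous_of_isOpen_ker φ hφ
    have hφH : Continuous fun x : H => φ (x : G) := hφc.comp continuous_subtype_val
    -- Local lifts: along a conjugate of the graph of `F i` in the first case, with trivial
    -- `V`-component in the second.
    rcases h H hH with ⟨i, a, hia⟩ | hsm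
    · let c : H →* D i :=
        { toFun := fun x => ⟨a⁻¹ * φ x * a, hia x x.2⟩
          map_one' := by ext; simp
          map_mul' := fun x y => by ext; simp [mul_assoc] }
      have hc : Continuous c := Continuous.subtype_mk
        ((continuous_const_mul a⁻¹).comp hφH |>.mul continuous_const) _
      refine ⟨_, Or.inl ⟨i, (a, 1), rfl⟩, (φ.comp H.subtype).prod ((F i).comp c),
        hφH.prodMk ((continuous_of_discreteTopology (f := F i)).comp hc), fun x => ?_, fun _ => rfl⟩
      rw [Subgroup.mem_map_conj, hgraph]
      exact ⟨hia x x.2, by simp [c]⟩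
    · refine ⟨(H.map φ).map (MonoidHom.inl A V), Or.inr ?_,
        (MonoidHom.inl A V).comp (φ.comp H.subtype),
        (continuous_of_discreteTopology (f := MonoidHom.inl A V)).comp hφH, fun x => ⟨φ x, ⟨x, x.2, rfl⟩, rfl⟩, fun _ => rfl⟩
      rw [Subgroup.map_map, MonoidHom.fst_comp_inl, Subgroup.map_id]
      exact hsm
  have hmaps : MapsFamily φ 𝒢 𝒜 := by
    intro H hH
    obtain ⟨E, hE, l, -, hl, hlφ⟩ := hloc H hH
    refine ⟨_, ⟨E, hE, rfl⟩, ?_⟩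
    rintro _ ⟨x, hx, rfl⟩
    exact ⟨l ⟨x, hx⟩, hl _, hlφ ⟨x, hx⟩⟩
  obtain ⟨γ, hγc, hγ, hγφ⟩ := hproj A (A × V) 𝒜 ℬ φ (MonoidHom.fst A V) inferInstance h𝒜 hℬ
    (continuous_of_isOpen_ker φ hφ) hmaps (fun a => ⟨(a, 1), rfl⟩) rfl hloc
  refine ⟨(MonoidHom.snd A V).comp γ, isOpen_ker_of_continuous _ (continuous_snd.comp hγc),
    fun H hH => ?_⟩
  obtain ⟨E, ⟨i, b, rfl⟩ | hE, hle⟩ := hγ H hH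
  · refine Or.inl ⟨i, b.1, fun x hx => ?_⟩
    have h1 := hle ⟨x, hx, rfl⟩
    rw [Subgroup.mem_map_conj, hgraph] at h1
    obtain ⟨h2, h3⟩ := h1
    have h4 : (b⁻¹ * γ x * b).1 = b.1⁻¹ * φ x * b.1 := by
      rw [← hγφ x]; rfl
    -- `V` is abelian, so conjugation in `A × V` leaves the `V`-component unchanged.
    have h5 : (b⁻¹ * γ x * b).2 = (γ x).2 := by
      simp [mul_comm]
    refine ⟨h4 ▸ h2, ?_⟩
    rw [h5] at h3
    refine h3.symm.trans ?_
    congr 1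
    exact Subtype.ext h4
  · refine Or.inr (mono _ _ ?_ hE)
    rintro _ ⟨x, hx, rfl⟩
    exact ⟨γ x, hle ⟨x, hx, rfl⟩, hγφ x⟩

/-- Two levels of quotients are needed. Modulo `N₀` the `f i` are defined and no `Γ (t i)` lies in a
conjugate of another `Γ (t j)`. Modulo `N`, any member containing `Γ (t i)` already lies in `Γ (t
i)` modulo `N₀`. Thus each member either has small image or maps into a conjugate of some `D i`. -/
theorem IsSProjectiveRel.exists_surjective {G : Type u} [Group G] [TopologicalSpace G]
    [IsTopologicalGroup G] [CompactSpace G] [T2Space G] [TotallyDisconnectedSpace G]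
    (hsol : IsProsoluble G) {T : Type v} [TopologicalSpace T] [CompactSpace T]
    {Γ : T → Subgroup G} (hΓ : IsContinuousFamily Γ) (hconj : ConjClosed (Set.range Γ))
    (hinj : ∀ s t : T, Γ s ≠ ⊥ → Γ s ≤ Γ t → s = t) (hproj : IsSProjectiveRel G (Set.range Γ))
    {n : ℕ} (t : Fin n → T) (ht : ∀ i, t i ∈ nontrivialIndices Γ)
    (hr : ∀ i j, conjIndexSetoid Γ (t i) (t j) → i = j)
    {V : Fin n → Type} [∀ i, CommGroup (V i)] [∀ i, Finite (V i)] (f : ∀ i, Γ (t i) →* V i)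
    (hf : ∀ i, IsOpen ((f i).ker : Set (Γ (t i)))) (hs : ∀ i, Function.Surjective (f i)) :
    ∃ χ : G →* ∀ i, V i, IsOpen (χ.ker : Set G) ∧ Function.Surjective χ := by
  obtain ⟨M, -⟩ := ProfiniteGrp.exist_openNormalSubgroup_sub_open_nhds_of_one
    (isOpen_univ : IsOpen (Set.univ : Set G)) trivial
  obtain ⟨N₁, -, hN₁⟩ := exists_openNormalSubgroup_forall_le
    (fun i (N : OpenNormalSubgroup G) => ∀ x : Γ (t i), (x : G) ∈ N → f i x = 1)
    (fun i N N' hle hN x hx => hN x (hle hx))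
    (fun i => exists_openNormalSubgroup_ker (f i) (hf i)) M
  have hnle : ∀ i j, i ≠ j → ∀ g : G, ¬ Γ (t i) ≤ (Γ (t j)).map (MulAut.conj g).toMonoidHom := by
    intro i j hij g hle
    obtain ⟨s, hsg⟩ := hconj _ ⟨t j, rfl⟩ g _ rfl
    have hts : t i = s := hinj _ _ (ht i) (hle.trans hsg.ge)
    refine hij (hr j i ⟨g, ?_⟩).symm
    rw [hts]
    exact hsg
  obtain ⟨N₀, hN₀₁, hN₀⟩ := exists_openNormalSubgroup_forall_le
    (fun (ij : Fin n × Fin n) (N : OpenNormalSubgroup G) => ij.1 ≠ ij.2 → ∀ g : G,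
      ¬ Γ (t ij.1) ≤ (Γ (t ij.2)).map (MulAut.conj g).toMonoidHom ⊔ (N : Subgroup G))
    (fun ij N N' hle hN hij g hN' => hN hij g (hN'.trans (OpenNormalSubgroup.sup_le_sup_left hle _)))
    (fun ij => by
      by_cases hij : ij.1 = ij.2
      · exact ⟨N₁, fun h => absurd hij h⟩
      · obtain ⟨N, -, hN⟩ := exists_openNormalSubgroup_conj_le (hΓ.isClosed (t ij.2))
          (hnle _ _ hij) N₁
        exact ⟨N, fun _ => hN⟩) N₁
  obtain ⟨N, -, hN⟩ := exists_openNormalSubgroup_forall_le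
    (fun i (N : OpenNormalSubgroup G) => ∀ s, Γ (t i) ≤ Γ s ⊔ (N : Subgroup G) →
      Γ s ≤ Γ (t i) ⊔ (N₀ : Subgroup G))
    (fun i N N' hle hN s hN' => hN s (hN'.trans (OpenNormalSubgroup.sup_le_sup_left hle _)))
    (fun i => by
      obtain ⟨N, -, hN⟩ := hΓ.exists_openNormalSubgroup hinj (ht i) N₀
      exact ⟨N, hN⟩) N₀
  obtain ⟨A₀, _, _, φ₀, hA₀, hφ₀, hker₀⟩ := exists_finite_quotient hsol N₀
  obtain ⟨A₁, _, _, φ₁, hA₁, hφ₁, hker₁⟩ := exists_finite_quotient hsol N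
  choose F₀ hF₀ using fun i => exists_factor φ₀ (f i) fun x hx => hN₁ i x (hN₀₁ (by
    have : (x : G) ∈ φ₀.ker := hx
    rw [hker₀] at this
    exact this))
  -- `A₁` detects which members are large, while `D` and `F` depend only on the `A₀`-component.
  let A := A₁ × A₀
  let φ : G →* A := φ₁.prod φ₀
  let D : Fin n → Subgroup A := fun i => ((Γ (t i)).map φ₀).comap (MonoidHom.snd A₁ A₀)
  classical
  let F : ∀ i, D i →* ∀ i, V i := fun i => (MonoidHom.mulSingle V i).comp
    (MonoidHom.mk' (fun d => F₀ i (d : A).2) (by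
      intro d e
      obtain ⟨x, hx, hxd⟩ := d.2
      obtain ⟨y, hy, hye⟩ := e.2
      have hxd' : φ₀ x = (d : A).2 := hxd
      have hye' : φ₀ y = (e : A).2 := hye
      have h1 := hF₀ i (⟨x, hx⟩ * ⟨y, hy⟩)
      rw [map_mul, ← hF₀ i, ← hF₀ i] at h1
      simp only [Subgroup.coe_mul, map_mul, hxd', hye'] at h1
      exact h1))
  let small : Subgroup A → Prop := fun K =>
    ∀ i a, ¬ ((Γ (t i)).map φ).map (MulAut.conj a).toMonoidHom ≤ K
  obtain ⟨χ, hχ, hχΓ⟩ := hproj.exists_hom (A := A) (V := ∀ i, V i) inferInstance φ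
    (by rw [MonoidHom.ker_prod, hker₀, hker₁]; exact N.isOpen'.inter N₀.isOpen') D F small
    (fun K L hKL hL i a hle => hL i a (hle.trans hKL))
    (fun K a hK i b hle => hK i (a⁻¹ * b) (by
      rw [← Subgroup.map_conj_map_conj]
      refine (Subgroup.map_mono hle).trans ?_
      rw [Subgroup.map_conj_map_conj, inv_mul_cancel]
      intro x hx
      simpa using Subgroup.mem_map_conj.mp hx))
    (by
      rintro _ ⟨s, rfl⟩
      refine or_iff_not_imp_right.mpr fun hsm => ?_
      simp only [small, not_forall, not_not] at hsm
      obtain ⟨i, a, hle⟩ := hsm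
      -- Only the `A₁`-component of `a` is lifted, since the containment is used modulo `N` alone;
      -- the new conjugator matters only in `A₀`.
      obtain ⟨g, hg⟩ := hφ₁ a.1
      refine ⟨i, (1, φ₀ g), ?_⟩
      obtain ⟨s', hs'⟩ := hconj _ ⟨s, rfl⟩ g⁻¹ _ rfl
      have hsub : Γ (t i) ≤ Γ s' ⊔ (N : Subgroup G) := by
        rw [← hker₁, ← Subgroup.comap_map_eq]
        intro x hx
        obtain ⟨y, hy, hyx⟩ := hle ⟨φ x, ⟨x, hx, rfl⟩, rfl⟩
        have h1 : φ₁ y = φ₁ g * φ₁ x * (φ₁ g)⁻¹ := by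
          rw [hg]; exact congrArg Prod.fst hyx
        refine ⟨g⁻¹ * y * g, ?_, ?_⟩
        · rw [hs']
          exact Subgroup.mem_map_conj.mpr (by simpa [mul_assoc] using hy)
        · simp [h1, mul_assoc]
      have hle' := hN i s' hsub
      intro x hx
      have hx' : g⁻¹ * x * g ∈ Γ s' := by
        rw [hs']
        exact Subgroup.mem_map_conj.mpr (by simpa [mul_assoc] using hx)
      have h2 := hle' hx'
      rw [← hker₀, ← Subgroup.comap_map_eq, Subgroup.mem_comap, map_mul, map_mul, map_inv] at h2
      exact h2)
  refine ⟨χ, hχ, surjective_of_mulSingle χ fun i v => ?_⟩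
  obtain ⟨y, rfl⟩ := hs i v
  -- The image of `Γ (t i)` contains itself, so it is not small and must go to a conjugate of a
  -- graph; the choice of `N₀` forces `j = i`.
  obtain ⟨j, a, hja⟩ | hsm := hχΓ _ ⟨t i, rfl⟩
  swap
  · refine absurd ?_ (hsm i 1)
    intro x hx
    simpa using Subgroup.mem_map_conj.mp hx
  obtain ⟨g, hg⟩ := hφ₀ a.2
  obtain rfl : i = j := by
    by_contra hij
    refine hN₀ (i, j) hij g ?_
    rw [← hker₀, ← Subgroup.comap_map_eq]
    intro x hx
    obtain ⟨hxD, -⟩ := hja x hx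
    change a.2⁻¹ * φ₀ x * a.2 ∈ (Γ (t j)).map φ₀ at hxD
    rw [Subgroup.mem_comap, Subgroup.map_conj_map, hg]
    exact Subgroup.mem_map_conj.mpr hxD
  have hmaps : ∀ z : (Γ (t i)).map φ₀, a.2⁻¹ * (z : A₀) * a.2 ∈ (Γ (t i)).map φ₀ := by
    rintro ⟨_, x, hx, rfl⟩
    exact (hja x hx).1
  let c : (Γ (t i)).map φ₀ → (Γ (t i)).map φ₀ := fun z => ⟨_, hmaps z⟩
  -- Conjugation by `a.2` permutes the finite group `φ₀ (Γ (t i))`, so twisting by it does not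
  -- shrink the image of `f i`.
  have hc : Function.Surjective c := Finite.surjective_of_injective fun z w hzw => by
    have h1 : a.2⁻¹ * (z : A₀) * a.2 = a.2⁻¹ * (w : A₀) * a.2 := congrArg Subtype.val hzw
    exact Subtype.ext (mul_left_cancel (mul_right_cancel h1))
  obtain ⟨⟨_, x, hx, rfl⟩, hxy⟩ := hc ⟨φ₀ y, ⟨y, y.2, rfl⟩⟩
  obtain ⟨hxD, hχx⟩ := hja x hx
  refine ⟨x, hχx.trans ?_⟩
  have h1 : a.2⁻¹ * φ₀ x * a.2 = φ₀ y := congrArg Subtype.val hxy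
  change Pi.mulSingle i (F₀ i (a.2⁻¹ * φ₀ x * a.2)) = _
  rw [h1, hF₀]

theorem IsSProjectiveRel.generatorBound {G : Type u} [Group G] [TopologicalSpace G]
    [IsTopologicalGroup G] [CompactSpace G] [T2Space G] [TotallyDisconnectedSpace G]
    (hsol : IsProsoluble G) (hfg : ∃ S : Finset G, TopGenerates G (S : Set G))
    {p : ℕ} [Fact p.Prime] {T : Type v} [TopologicalSpace T] [CompactSpace T]
    {Γ : T → Subgroup G} (hΓ : IsContinuousFamily Γ) (hconj : ConjClosed (Set.range Γ))
    (hinj : ∀ s t : T, Γ s ≠ ⊥ → Γ s ≤ Γ t → s = t) (hproj : IsSProjectiveRel G (Set.range Γ))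
    (hP : ∀ t : T, IsProP p (Γ t)) : GeneratorBound (conjIndexSetoid Γ) Γ := by
  have hbot : ∀ (H : Subgroup G) (g : G), H ≠ ⊥ → H.map (MulAut.conj g).toMonoidHom ≠ ⊥ :=
    fun H g hH h => hH ((Subgroup.map_eq_bot_iff_of_injective H (MulAut.conj g).injective).mp h)
  refine generatorBound_of_surjective hfg _ _ hΓ.isClosed hP (fun t ht => ⟨?_, ?_⟩)
    (fun n t ht hr V _ _ f hf hs => hproj.exists_surjective hsol hΓ hconj hinj t ht hr f hf hs)
  · have : {s | conjIndexSetoid Γ t s} =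
        {s | ∃ g : G, (Γ t).map (MulAut.conj g).toMonoidHom ≤ Γ s} := by
      ext s
      constructor
      · rintro ⟨g, hg⟩
        exact ⟨g, hg.ge⟩
      · rintro ⟨g, hg⟩
        obtain ⟨s', hs'⟩ := hconj _ ⟨t, rfl⟩ g _ rfl
        -- Incomparability turns containment of a conjugate into equality, so the class is the
        -- closed set of `isClosed_conj`.
        have : s' = s := hinj s' s (hs' ▸ hbot _ g ht) (hs' ▸ hg)
        exact ⟨g, this ▸ hs'⟩
    rw [this]
    exact hΓ.isClosed_conj (Γ t)
  · rintro s ⟨g, hg⟩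
    change Γ s ≠ ⊥
    rw [hg]
    exact hbot _ g ht

theorem mainTheorem9
    (G : Type u) [Group G] [TopologicalSpace G] [IsTopologicalGroup G]
    [CompactSpace G] [T2Space G] [TotallyDisconnectedSpace G]
    (hsol : IsProsoluble G)
    (hfg : ∃ S : Finset G, TopGenerates G (S : Set G))
    (p : ℕ) (hp : p.Prime) :
    -- point stabilizers of an `𝒮`-projective pile
    (∀ (T : Type v) [TopologicalSpace T] [CompactSpace T] [T2Space T]
      [TotallyDisconnectedSpace T] [MulAction G T] [ContinuousSMul G T],
      IsSProjectivePile G T →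
      (∀ t : T, IsProP p ↥(MulAction.stabilizer G t)) →
      GeneratorBound (MulAction.orbitRel G T) (fun t : T => MulAction.stabilizer G t)) ∧
    -- continuous families of subgroups, closed for conjugation
    (∀ (T : Type v) [TopologicalSpace T] [CompactSpace T] [T2Space T]
      [TotallyDisconnectedSpace T] (Γ : T → Subgroup G),
      IsContinuousFamily Γ → ConjClosed (Set.range Γ) →
      (∀ s t : T, Γ s ≠ ⊥ → Γ s ≤ Γ t → s = t) →
      IsSProjectiveRel G (Set.range Γ) →
      (∀ t : T, IsProP p ↥(Γ t)) →
      GeneratorBound (conjIndexSetoid Γ) Γ) := by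
  have : Fact p.Prime := ⟨hp⟩
  exact ⟨fun _ _ _ _ _ _ _ h hP => h.generatorBound hsol hfg hP,
    fun _ _ _ _ _ _ hΓ hconj hinj h hP => h.generatorBound hsol hfg hΓ hconj hinj hP⟩
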